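/- Let $p>2$ be a prime, $m>1$ an integer, $\omega$ a primitive element of $\mathbb{F}_{p^m}$ (a generator of its multiplicative group), and $N=2(p^m-1)/(p-1)$. Let $\mathrm{Tr}:\mathbb{F}_{p^m}\to\mathbb{F}_p$ be the trace and $\left(\frac{\cdot}{p}\right)$ the Legendre symbol. Define sequences $T^{(1)}=(t^{(1)}_n)_{n\ge 0}$ and $T^{(2)}=(t^{(2)}_n)_{n\ge 0}$ over $\mathbb{F}_2$ by $$t^{(1)}_n=t^{(2)}_n=0 \text{ if } \left(\tfrac{\mathrm{Tr}(\omega^n)}{p}\right)=1,\qquad t^{(1)}_n=t^{(2)}_n=1 \text{ if } \left(\tfrac{\mathrm{Tr}(\omega^n)}{p}\right)=-1,\qquad t^{(1)}_n=0,\ t^{(2)}_n=1 \text{ if } \mathrm{Tr}(\omega^n)=0.$$ For an $N$-periodic sequence $S=(s_n)_{n\ge0}$ over $\mathbb{F}_2$ let $R_S(\tau)=\sum_{i=0}^{N-1}(-1)^{s_i+s_{i+\tau}}$ be its periodic autocorrelation, and let the linear complexity $L(S)$ be the least $L\ge 0$ such that, for some $a_0,\dots,a_{L-1}\in\mathbb{F}_2$,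 $s_{n+L}=a_{L-1}s_{n+L-1}+\cdots+a_0s_n$ for all $n\ge0$. Then: 1. $T^{(1)}$ and $T^{(2)}$ have the same least positive period, namely $N$; 2. $R_{T^{(2)}}(\tau)=R_{T^{(1)}}(\tau)$ for all integers $\tau\ge 0$ (in particular for $0\le\tau\le N-1$); 3. $L(T^{(2)})=L(T^{(1)})$. -/

import Mathlib

/-- The geometric sequence of the first type over `F_2`: the `n`-th term is `0`, `1`, `0` according
as the Legendre symbol of `Tr (ω ^ n)` is `1`, `-1`, `0`. -/
noncomputable def geomSeq1 (p : ℕ) [Fact p.Prime] {K : Type*} [Field K] [Algebra (ZMod p) K]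
    (ω : K) (n : ℕ) : ZMod 2 :=
  if legendreSym p ((Algebra.trace (ZMod p) K (ω ^ n)).val : ℤ) = 1 then 0
  else if legendreSym p ((Algebra.trace (ZMod p) K (ω ^ n)).val : ℤ) = -1 then 1
  else 0

/-- The geometric sequence of the second type over `F_2`: the `n`-th term is `0`, `1`, `1` according
as the Legendre symbol of `Tr (ω ^ n)` is `1`, `-1`, `0`. -/
noncomputable def geomSeq2 (p : ℕ) [Fact p.Prime] {K : Type*} [Field K] [Algebra (ZMod p) K]
    (ω : K) (n : ℕ) : ZMod 2 :=
  if legendreSym p ((Algebra.trace (ZMod p) K (ω ^ n)).val : ℤ) = 1 then 0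
  else if legendreSym p ((Algebra.trace (ZMod p) K (ω ^ n)).val : ℤ) = -1 then 1
  else 1

/-- `N` is the (least positive) period of the sequence `S`. -/
def IsLeastPeriod {α : Type*} (S : ℕ → α) (N : ℕ) : Prop :=
  IsLeast {P : ℕ | 0 < P ∧ Function.Periodic S P} N

/-- The periodic correlation `∑_{i < N} (-1) ^ (s_i + s'_{i + τ})` of two `N`-periodic binary
sequences; the sum in the exponent is taken in `F_2`. -/
def periodicCorrelation (N : ℕ) (S S' : ℕ → ZMod 2) (τ : ℕ) : ℤ :=
  ∑ i ∈ Finset.range N, (-1 : ℤ) ^ (S i + S' (i + τ)).val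

/-- The periodic autocorrelation of an `N`-periodic binary sequence. -/
def periodicAutocorrelation (N : ℕ) (S : ℕ → ZMod 2) (τ : ℕ) : ℤ :=
  periodicCorrelation N S S τ

/-- The linear complexity of `S`: the least order of a linear recurrence
`s_{n+L} = a_0 s_n + ⋯ + a_{L-1} s_{n+L-1}` (for all `n ≥ 0`) that `S` satisfies
(and `⊤` if there is none). -/
noncomputable def linearComplexity {F : Type*} [Field F] (S : ℕ → F) : ℕ∞ :=
  ⨅ (E : LinearRecurrence F) (_ : E.IsSolution S), (E.order : ℕ∞)

/-! Let M = N/2. The element ω^M generates the multiplicative group of F_p, hence is a non-residue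
c, and Tr(ω^(n+M)) = c Tr(ω^n). So shifting by M flips the Legendre symbol and keeps zeros: each
sequence is the complement of the other shifted by M. Periods and autocorrelation survive this. A
recurrence survives complementing if the constant 1 satisfies it, that is, if its coefficients sum
to 1. Summing it over a period forces this when the period sum is nonzero in F_2; that sum is the
number of n < M with nonzero trace, p^(m-1), which is odd. For minimality, the sum of the two
sequences marks the zeros of the trace. A period P thus makes ω^P preserve the trace-zero
hyperplane, so ω^P lies in F_p and M divides P; the complementing shift rules out odd multiples. -/

/-! ### Binary sequences that are complements of shifts of each other -/

/-- Summing a periodic function over a full period is invariant under shifts. -/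
theorem Function.Periodic.sum_range_add_eq {α : Type*} [AddCommGroup α] {f : ℕ → α} {N : ℕ}
    (hf : Function.Periodic f N) (k : ℕ) :
    ∑ i ∈ Finset.range N, f (i + k) = ∑ i ∈ Finset.range N, f i := by
  induction k with
  | zero => simp
  | succ k ih =>
    rw [← ih]
    have h1 := Finset.sum_range_succ (fun i => f (i + k)) N
    have h2 := Finset.sum_range_succ' (fun i => f (i + k)) N
    have h3 : f (N + k) = f (0 + k) := by rw [zero_add, add_comm, hf]
    simp only [h3] at h1
    rw [h1] at h2
    have h4 := add_right_cancel h2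
    rw [h4]
    exact Finset.sum_congr rfl fun i _ => by congr 1; ring

theorem Function.Periodic.of_complement_shift {S S' : ℕ → ZMod 2} {M P : ℕ}
    (h : ∀ n, S' n = 1 + S (n + M)) (hS : Function.Periodic S P) : Function.Periodic S' P :=
  fun n => by rw [h, h, add_right_comm, hS]

/-- The two added ones cancel in the exponent, and the shift permutes a full period. -/
theorem periodicAutocorrelation_complement_shift {S S' : ℕ → ZMod 2} {M N : ℕ}
    (h : ∀ n, S' n = 1 + S (n + M)) (hS : Function.Periodic S N) (τ : ℕ) :
    periodicAutocorrelation N S' τ = periodicAutocorrelation N S τ := by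
  have hf : Function.Periodic (fun i => (-1 : ℤ) ^ (S i + S (i + τ)).val) N := fun i => by
    simp only [add_right_comm i N τ, hS i, hS (i + τ)]
  unfold periodicAutocorrelation periodicCorrelation
  rw [← hf.sum_range_add_eq M]
  refine Finset.sum_congr rfl fun i _ => ?_
  have e : S' i + S' (i + τ) = S (i + M) + S (i + M + τ) := by
    rw [h, h, add_right_comm i τ M]
    linear_combination (CharTwo.add_self_eq_zero (1 : ZMod 2))
  rw [e]

/-- The coefficients of a recurrence satisfied by a periodic sequence with nonzero sum over a
period add up to `1`. -/
theorem LinearRecurrence.sum_coeffs_eq_one {F : Type*} [Field F] {E : LinearRecurrence F}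
    {S : ℕ → F} {N : ℕ} (hE : E.IsSolution S) (hS : Function.Periodic S N)
    (hsum : ∑ i ∈ Finset.range N, S i ≠ 0) : ∑ i, E.coeffs i = 1 := by
  have h1 : ∑ n ∈ Finset.range N, S (n + E.order)
      = ∑ n ∈ Finset.range N, ∑ i, E.coeffs i * S (n + i) :=
    Finset.sum_congr rfl fun n _ => hE n
  rw [hS.sum_range_add_eq, Finset.sum_comm] at h1
  simp_rw [← Finset.mul_sum, hS.sum_range_add_eq] at h1
  rw [← Finset.sum_mul] at h1
  exact mul_right_cancel₀ hsum (by rw [← h1, one_mul])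

theorem LinearRecurrence.IsSolution.complement_shift {E : LinearRecurrence (ZMod 2)}
    {S S' : ℕ → ZMod 2} {M : ℕ} (h : ∀ n, S' n = 1 + S (n + M)) (hE : E.IsSolution S)
    (hc : ∑ i, E.coeffs i = 1) : E.IsSolution S' := by
  intro n
  simp_rw [h, mul_add, Finset.sum_add_distrib, mul_one]
  rw [hc, add_right_comm n E.order M, hE (n + M)]
  simp_rw [add_right_comm n M]

theorem linearComplexity_le_of_complement_shift {S S' : ℕ → ZMod 2} {M N : ℕ}
    (h : ∀ n, S' n = 1 + S (n + M)) (hS : Function.Periodic S N)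
    (hsum : ∑ i ∈ Finset.range N, S i ≠ 0) : linearComplexity S' ≤ linearComplexity S :=
  le_iInf₂ fun E hE =>
    iInf₂_le E (hE.complement_shift h (E.sum_coeffs_eq_one hE hS hsum))

/-! ### The trace and powers of a primitive element -/

section Trace

variable {p : ℕ} [Fact p.Prime] {K : Type*} [Field K] [Algebra (ZMod p) K]

local notation "tr" => Algebra.trace (ZMod p) K

/-- An element preserving the hyperplane of trace zero by multiplication is a scalar. -/
theorem exists_algebraMap_eq_of_trace_mul_eq_zero [Finite K] {a : K}
    (h : ∀ x : K, tr x = 0 → tr (a * x) = 0) :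
    ∃ c : ZMod p, algebraMap (ZMod p) K c = a := by
  obtain ⟨b, hb⟩ := Algebra.trace_surjective (ZMod p) K 1
  refine ⟨tr (a * b), ?_⟩
  by_contra hne
  obtain ⟨y, hy⟩ := Algebra.trace_surjective (ZMod p) K 1
  -- Subtracting `tr x • b` moves `x` into the kernel, since `b` has trace 1.
  have key : ∀ x : K, tr (a * x) = tr (a * b) * tr x := fun x => by
    have h0 : tr (x - tr x • b) = 0 := by simp [hb]
    have h1 := h _ h0
    rw [mul_sub, mul_smul_comm, map_sub, map_smul, smul_eq_mul, sub_eq_zero] at h1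
    rw [h1, mul_comm]
  have hz : a - algebraMap (ZMod p) K (tr (a * b)) ≠ 0 := sub_ne_zero.2 (Ne.symm hne)
  have h2 : tr ((a - algebraMap (ZMod p) K (tr (a * b))) *
      ((a - algebraMap (ZMod p) K (tr (a * b)))⁻¹ * y)) = 0 := by
    rw [sub_mul, map_sub, key, ← Algebra.smul_def, map_smul, smul_eq_mul, sub_self]
  rw [mul_inv_cancel_left₀ hz, hy] at h2
  exact one_ne_zero h2

theorem card_trace_ne_zero [Finite K] :
    Nat.card {x : K // tr x ≠ 0} = p ^ (Module.finrank (ZMod p) K - 1) * (p - 1) := by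
  classical
  have := Fintype.ofFinite K
  obtain ⟨k, hk⟩ : ∃ k, Module.finrank (ZMod p) K = k + 1 :=
    ⟨_, (Nat.succ_pred_eq_of_pos Module.finrank_pos).symm⟩
  rw [hk]
  have hp : 0 < p := (Fact.out : p.Prime).pos
  have hcard : Nat.card K = p ^ (k + 1) := by
    rw [Nat.card_eq_fintype_card, Module.card_eq_pow_finrank (K := ZMod p), ZMod.card, hk]
  have hq : Nat.card (K ⧸ LinearMap.ker (tr)) = p := by
    rw [Nat.card_congr ((tr).quotKerEquivOfSurjective
      (Algebra.trace_surjective (ZMod p) K)).toEquiv, Nat.card_zmod]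
  have hmul := Submodule.card_eq_card_quotient_mul_card (LinearMap.ker (tr))
  rw [hq, hcard] at hmul
  have hker : Nat.card {x : K // tr x = 0} = p ^ k := by
    have e : Nat.card {x : K // tr x = 0} = Nat.card (LinearMap.ker (tr)) := rfl
    rw [e]
    exact Nat.eq_of_mul_eq_mul_right hp (by rw [← hmul, pow_succ])
  have hc := Fintype.card_subtype_compl (fun x : K => tr x = 0)
  simp only [← Nat.card_eq_fintype_card] at hc
  have hc' : Nat.card {x : K // tr x ≠ 0} = p ^ (k + 1) - p ^ k := by
    rw [← hcard, ← hker]; exact hc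
  rw [hc', Nat.add_sub_cancel, Nat.mul_sub, pow_succ, mul_one]

variable {ω : K} {M : ℕ}

/-- Frobenius fixes `ω ^ M`, and its fixed field is the prime field. -/
theorem exists_algebraMap_eq_pow (hω : IsPrimitiveRoot ω (M * (p - 1))) :
    ∃ c : ZMod p, algebraMap (ZMod p) K c = ω ^ M := by
  have hp : 0 < p := (Fact.out : p.Prime).pos
  have : CharP K p := charP_of_injective_algebraMap (algebraMap (ZMod p) K).injective p
  have h1 : (ω ^ M) ^ p = ω ^ M := by
    conv_lhs => rw [← Nat.sub_add_cancel hp, pow_succ, ← pow_mul, hω.pow_eq_one, one_mul]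
  rw [← Subfield.mem_bot_iff_pow_eq_self, mem_bot_iff_intCast p] at h1
  obtain ⟨c, hc⟩ := h1
  exact ⟨c, by rw [map_intCast, hc]⟩

theorem dvd_of_pow_eq_algebraMap (hω : IsPrimitiveRoot ω (M * (p - 1))) (hω0 : ω ≠ 0) {P : ℕ}
    {c : ZMod p} (hc : algebraMap (ZMod p) K c = ω ^ P) : M ∣ P := by
  have hp := (Fact.out : p.Prime).two_le
  have hc0 : c ≠ 0 := by
    rintro rfl
    exact pow_ne_zero P hω0 (by rw [← hc, map_zero])
  have h1 : ω ^ (P * (p - 1)) = 1 := by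
    rw [pow_mul, ← hc, ← map_pow, ZMod.pow_card_sub_one_eq_one hc0, map_one]
  exact Nat.dvd_of_mul_dvd_mul_right (by omega) ((hω.pow_eq_one_iff_dvd _).1 h1)

/-- If `c` were a square, `ω ^ M` would have order at most (p - 1)/2 instead of p - 1. -/
theorem quadraticChar_eq_neg_one_of_pow_eq (hp : 2 < p) (hM : 0 < M)
    (hω : IsPrimitiveRoot ω (M * (p - 1))) {c : ZMod p}
    (hc : algebraMap (ZMod p) K c = ω ^ M) : quadraticChar (ZMod p) c = -1 := by
  have hodd : p % 2 = 1 := (Fact.out : p.Prime).mod_two_eq_one_iff_ne_two.2 hp.ne'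
  rw [quadraticChar_neg_one_iff_not_isSquare]
  rintro ⟨d, rfl⟩
  have hd0 : d ≠ 0 := by
    rintro rfl
    rw [mul_zero, map_zero] at hc
    have h0 := hω.pow_eq_one
    rw [pow_mul, ← hc, zero_pow (by omega)] at h0
    exact zero_ne_one h0
  have h1 : ω ^ (M * ((p - 1) / 2)) = 1 := by
    rw [pow_mul, ← hc, ← map_pow, ← sq, ← pow_mul, Nat.mul_div_cancel' (by omega),
      ZMod.pow_card_sub_one_eq_one hd0, map_one]
  have h2 := Nat.le_of_dvd (by omega)
    (Nat.dvd_of_mul_dvd_mul_left hM ((hω.pow_eq_one_iff_dvd _).1 h1))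
  omega

theorem trace_pow_add {c : ZMod p} (hc : algebraMap (ZMod p) K c = ω ^ M) (n : ℕ) :
    tr (ω ^ (n + M)) = c * tr (ω ^ n) := by
  rw [pow_add, mul_comm, ← hc, ← Algebra.smul_def, map_smul, smul_eq_mul]

theorem exists_pow_eq_of_ne_zero [Finite K] (hω : IsPrimitiveRoot ω (Nat.card K - 1)) {x : K}
    (hx : x ≠ 0) : ∃ n < Nat.card K - 1, ω ^ n = x := by
  have := Fintype.ofFinite K
  have h2 : 1 < Nat.card K := Finite.one_lt_card
  have : NeZero (Nat.card K - 1) := ⟨by omega⟩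
  refine hω.eq_pow_of_pow_eq_one ?_
  rw [Nat.card_eq_fintype_card]
  exact FiniteField.pow_card_sub_one_eq_one x hx

theorem card_filter_trace_pow_ne_zero [Finite K] (hω : IsPrimitiveRoot ω (Nat.card K - 1)) :
    ((Finset.range (Nat.card K - 1)).filter fun n => tr (ω ^ n) ≠ 0).card =
      Nat.card {x : K // tr x ≠ 0} := by
  classical
  have := Fintype.ofFinite K
  rw [Nat.card_eq_fintype_card (α := {x : K // tr x ≠ 0}), Fintype.card_subtype]
  refine Finset.card_bij (fun n _ => ω ^ n) ?_ ?_ ?_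
  · intro n hn
    simpa using (Finset.mem_filter.1 hn).2
  · intro i hi j hj h
    exact hω.pow_inj (Finset.mem_range.1 (Finset.mem_filter.1 hi).1)
      (Finset.mem_range.1 (Finset.mem_filter.1 hj).1) h
  · intro x hx
    have hx' : tr x ≠ 0 := by simpa using hx
    have hx0 : x ≠ 0 := fun h => hx' (by rw [h, map_zero])
    obtain ⟨n, hn, rfl⟩ := exists_pow_eq_of_ne_zero hω hx0
    exact ⟨n, Finset.mem_filter.2 ⟨Finset.mem_range.2 hn, hx'⟩, rfl⟩

theorem Function.Periodic.sum_range_mul {f : ℕ → ℕ} (hf : Function.Periodic f M) (k : ℕ) :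
    ∑ i ∈ Finset.range (M * k), f i = k * ∑ i ∈ Finset.range M, f i := by
  induction k with
  | zero => simp
  | succ k ih =>
    rw [Nat.mul_succ, Finset.sum_range_add, ih, Nat.succ_mul]
    congr 1
    refine Finset.sum_congr rfl fun i _ => ?_
    rw [add_comm, mul_comm]
    exact hf.nat_mul k i

/-- Among `M` consecutive powers of `ω`, an odd number has nonzero trace. -/
theorem sum_trace_pow_ne_zero [Finite K] (hp : 2 < p) (hcard : Nat.card K = M * (p - 1) + 1)
    (hω : IsPrimitiveRoot ω (M * (p - 1))) {c : ZMod p} (hc0 : c ≠ 0)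
    (hc : algebraMap (ZMod p) K c = ω ^ M) :
    ∑ n ∈ Finset.range M, (if tr (ω ^ n) = 0 then (0 : ZMod 2) else 1) = 1 := by
  have hper : Function.Periodic (fun n => if tr (ω ^ n) ≠ 0 then 1 else 0) M := fun n => by
    simp only [trace_pow_add hc, ne_eq, mul_eq_zero, hc0, false_or]
  have hcard' : Nat.card K - 1 = M * (p - 1) := by omega
  have h1 := card_filter_trace_pow_ne_zero (p := p) (hcard'.symm ▸ hω)
  -- The full cycle of powers consists of p - 1 blocks of length `M` with equal counts.
  rw [card_trace_ne_zero, Finset.card_filter, hcard', hper.sum_range_mul, mul_comm] at h1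
  have h2 := Nat.eq_of_mul_eq_mul_right (by omega) h1
  have h3 : Odd (p ^ (Module.finrank (ZMod p) K - 1)) :=
    ((Fact.out : p.Prime).odd_of_ne_two hp.ne').pow
  rw [← h2, ← ZMod.natCast_eq_one_iff_odd, Nat.cast_sum] at h3
  rw [← h3]
  exact Finset.sum_congr rfl fun n _ => by split_ifs <;> simp_all

/-! ### The two geometric sequences -/

theorem legendreSym_val_trace_eq_quadraticChar (n : ℕ) :
    legendreSym p ((tr (ω ^ n)).val : ℤ) = quadraticChar (ZMod p) (tr (ω ^ n)) := by
  simp [legendreSym]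

theorem geomSeq1_add_geomSeq2 (n : ℕ) :
    geomSeq1 p ω n + geomSeq2 p ω n = if tr (ω ^ n) = 0 then 1 else 0 := by
  unfold geomSeq1 geomSeq2
  rw [legendreSym_val_trace_eq_quadraticChar]
  by_cases h : tr (ω ^ n) = 0
  · simp [h]
  · rcases quadraticChar_dichotomy h with h1 | h1
    · simp [h, h1]
    · simp [h, h1, CharTwo.add_self_eq_zero]

variable {c : ZMod p}

theorem geomSeq2_eq_one_add_geomSeq1 (hc : algebraMap (ZMod p) K c = ω ^ M)
    (hχ : quadraticChar (ZMod p) c = -1) (n : ℕ) :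
    geomSeq2 p ω n = 1 + geomSeq1 p ω (n + M) := by
  unfold geomSeq1 geomSeq2
  rw [legendreSym_val_trace_eq_quadraticChar, legendreSym_val_trace_eq_quadraticChar,
    trace_pow_add hc, map_mul, hχ]
  by_cases h : tr (ω ^ n) = 0
  · simp [h]
  · rcases quadraticChar_dichotomy h with h1 | h1
    · simp [h1, CharTwo.add_self_eq_zero]
    · simp [h1]

theorem geomSeq1_eq_one_add_geomSeq2 (hc : algebraMap (ZMod p) K c = ω ^ M)
    (hχ : quadraticChar (ZMod p) c = -1) (n : ℕ) :
    geomSeq1 p ω n = 1 + geomSeq2 p ω (n + M) := by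
  unfold geomSeq1 geomSeq2
  rw [legendreSym_val_trace_eq_quadraticChar, legendreSym_val_trace_eq_quadraticChar,
    trace_pow_add hc, map_mul, hχ]
  by_cases h : tr (ω ^ n) = 0
  · simp [h, CharTwo.add_self_eq_zero]
  · rcases quadraticChar_dichotomy h with h1 | h1
    · simp [h1, CharTwo.add_self_eq_zero]
    · simp [h1]

theorem geomSeq1_periodic (hc : algebraMap (ZMod p) K c = ω ^ M)
    (hχ : quadraticChar (ZMod p) c = -1) : Function.Periodic (geomSeq1 p ω) (2 * M) := fun n => by
  rw [two_mul, ← add_assoc, geomSeq1_eq_one_add_geomSeq2 hc hχ n,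
    geomSeq2_eq_one_add_geomSeq1 hc hχ (n + M), ← add_assoc, CharTwo.add_self_eq_zero, zero_add]

/-- The terms at `n` and `n + M` differ exactly when the trace is nonzero. -/
theorem sum_geomSeq1 (hc : algebraMap (ZMod p) K c = ω ^ M)
    (hχ : quadraticChar (ZMod p) c = -1)
    (hodd : ∑ n ∈ Finset.range M, (if tr (ω ^ n) = 0 then (0 : ZMod 2) else 1) = 1) :
    ∑ n ∈ Finset.range (2 * M), geomSeq1 p ω n = 1 := by
  rw [two_mul, Finset.sum_range_add, ← Finset.sum_add_distrib, ← hodd]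
  refine Finset.sum_congr rfl fun n _ => ?_
  have h1 := geomSeq1_add_geomSeq2 (p := p) (ω := ω) n
  rw [geomSeq2_eq_one_add_geomSeq1 hc hχ n, add_comm n M] at h1
  have h2 := CharTwo.add_self_eq_zero (1 : ZMod 2)
  split_ifs at h1 ⊢ <;> grind

theorem sum_geomSeq2 (hc : algebraMap (ZMod p) K c = ω ^ M)
    (hχ : quadraticChar (ZMod p) c = -1)
    (hodd : ∑ n ∈ Finset.range M, (if tr (ω ^ n) = 0 then (0 : ZMod 2) else 1) = 1) :
    ∑ n ∈ Finset.range (2 * M), geomSeq2 p ω n = 1 := by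
  simp_rw [geomSeq2_eq_one_add_geomSeq1 hc hχ, Finset.sum_add_distrib]
  rw [(geomSeq1_periodic hc hχ).sum_range_add_eq, sum_geomSeq1 hc hχ hodd]
  have h2 : (2 : ZMod 2) = 0 := rfl
  simp [h2]

/-- Every period of `geomSeq1` is a multiple of `2 * M`. -/
theorem two_mul_dvd_of_periodic_geomSeq1 [Finite K] (hω : IsPrimitiveRoot ω (Nat.card K - 1))
    (hcard : Nat.card K - 1 = M * (p - 1))
    (hc : algebraMap (ZMod p) K c = ω ^ M) (hχ : quadraticChar (ZMod p) c = -1) {P : ℕ}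
    (hP : Function.Periodic (geomSeq1 p ω) P) : 2 * M ∣ P := by
  have hq : 1 < Nat.card K := Finite.one_lt_card
  have hω0 : ω ≠ 0 := hω.ne_zero (by omega)
  have hP2 := hP.of_complement_shift (geomSeq2_eq_one_add_geomSeq1 hc hχ)
  have hz : ∀ n, tr (ω ^ n) = 0 → tr (ω ^ (n + P)) = 0 := fun n hn => by
    have h1 := geomSeq1_add_geomSeq2 (p := p) (ω := ω) n
    have h2 := geomSeq1_add_geomSeq2 (p := p) (ω := ω) (n + P)
    rw [hP n, hP2 n, h1, if_pos hn] at h2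
    by_contra hne
    rw [if_neg hne] at h2
    exact one_ne_zero h2
  obtain ⟨d, hd⟩ : ∃ d : ZMod p, algebraMap (ZMod p) K d = ω ^ P := by
    refine exists_algebraMap_eq_of_trace_mul_eq_zero fun x hx => ?_
    by_cases hx0 : x = 0
    · rw [hx0, mul_zero, map_zero]
    · obtain ⟨n, -, rfl⟩ := exists_pow_eq_of_ne_zero hω hx0
      rw [← pow_add, add_comm]
      exact hz n hx
  obtain ⟨k, rfl⟩ := dvd_of_pow_eq_algebraMap (hcard ▸ hω) hω0 hd
  rcases Nat.even_or_odd' k with ⟨j, rfl | rfl⟩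
  · exact ⟨j, by ring⟩
  -- An odd multiple of `M` would make the complementing shift by `M` a period, which fails where
  -- the trace is 1.
  · exfalso
    obtain ⟨y, hy⟩ := Algebra.trace_surjective (ZMod p) K 1
    obtain ⟨n, -, rfl⟩ := exists_pow_eq_of_ne_zero hω
      (x := y) (by rintro rfl; rw [map_zero] at hy; exact zero_ne_one hy)
    have h1 := geomSeq1_add_geomSeq2 (p := p) (ω := ω) n
    have h3 := (geomSeq1_periodic hc hχ).nat_mul j (n + M)
    have e : n + M + j * (2 * M) = n + M * (2 * j + 1) := by ring
    rw [Nat.cast_id, e, hP n] at h3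
    rw [geomSeq2_eq_one_add_geomSeq1 hc hχ n, ← h3, hy, if_neg one_ne_zero, add_left_comm,
      CharTwo.add_self_eq_zero, add_zero] at h1
    exact one_ne_zero h1

end Trace

theorem mainTheorem9 (p m : ℕ) [Fact p.Prime] (hp : 2 < p) (hm : 1 < m)
    {K : Type*} [Field K] [Finite K] [Algebra (ZMod p) K]
    (hK : Module.finrank (ZMod p) K = m)
    (ω : K) (hω : IsPrimitiveRoot ω (p ^ m - 1))
    (N : ℕ) (hN : N = 2 * (p ^ m - 1) / (p - 1)) :
    (IsLeastPeriod (geomSeq1 p ω) N ∧ IsLeastPeriod (geomSeq2 p ω) N) ∧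
    (∀ τ : ℕ, periodicAutocorrelation N (geomSeq2 p ω) τ
      = periodicAutocorrelation N (geomSeq1 p ω) τ) ∧
    linearComplexity (geomSeq2 p ω) = linearComplexity (geomSeq1 p ω) := by
  obtain ⟨M, hM⟩ : p - 1 ∣ p ^ m - 1 := by
    simpa using Nat.sub_dvd_pow_sub_pow p 1 m
  rw [mul_comm] at hM
  have hcard : Nat.card K = p ^ m := by
    have := Fintype.ofFinite K
    rw [Nat.card_eq_fintype_card, Module.card_eq_pow_finrank (K := ZMod p), ZMod.card, hK]
  have hq : 1 < p ^ m := Nat.one_lt_pow (by omega) (by omega)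
  have hM0 : 0 < M := Nat.pos_of_ne_zero fun h => by rw [h, zero_mul] at hM; omega
  have hNM : N = 2 * M := by
    rw [hN, hM, ← mul_assoc, Nat.mul_div_cancel _ (by omega)]
  subst hNM
  have hω' : IsPrimitiveRoot ω (Nat.card K - 1) := by rwa [hcard]
  rw [hM] at hω
  obtain ⟨c, hc⟩ := exists_algebraMap_eq_pow hω
  have hχ := quadraticChar_eq_neg_one_of_pow_eq hp hM0 hω hc
  have hc0 : c ≠ 0 := by
    rintro rfl
    simp at hχ
  have hodd := sum_trace_pow_ne_zero hp (by omega) hω hc0 hc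
  have h12 := geomSeq1_eq_one_add_geomSeq2 hc hχ
  have h21 := geomSeq2_eq_one_add_geomSeq1 hc hχ
  have hper1 := geomSeq1_periodic hc hχ
  have hper2 := hper1.of_complement_shift h21
  have hdvd : ∀ P, Function.Periodic (geomSeq1 p ω) P → 2 * M ∣ P := fun P hP =>
    two_mul_dvd_of_periodic_geomSeq1 hω' (by omega) hc hχ hP
  refine ⟨⟨⟨⟨by omega, hper1⟩, fun P hP => ?_⟩, ⟨⟨by omega, hper2⟩, fun P hP => ?_⟩⟩,
    periodicAutocorrelation_complement_shift h21 hper1, le_antisymm ?_ ?_⟩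
  · exact Nat.le_of_dvd hP.1 (hdvd P hP.2)
  · exact Nat.le_of_dvd hP.1 (hdvd P (hP.2.of_complement_shift h12))
  · exact linearComplexity_le_of_complement_shift h21 hper1
      (by rw [sum_geomSeq1 hc hχ hodd]; exact one_ne_zero)
  · exact linearComplexity_le_of_complement_shift h12 hper2
      (by rw [sum_geomSeq2 hc hχ hodd]; exact one_ne_zero)
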